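/- Let $\kappa\ge 0$ be an integer, $\alpha\in[0,1]$ and $C\in\mathbb R$. For every real $m>0$ there is a constant $K_m$, depending only on $m,\kappa,\alpha,C$, such that the following holds. Let $I=[a,b]\subset\mathbb R$ with $a<b$, and write $|I|=b-a$. For a set $S\subseteq\mathbb R$, $f\in C^{n,\alpha}(S)$ means that $f$ is $n$ times continuously differentiable on $S$ and $|f^{(n)}(x)-f^{(n)}(y)|\le M|x-y|^\alpha$ for all $x,y\in S$ with some finite $M$ (derivatives at the endpoints of an interval being one-sided, and $|x-y|^0=1$). Let $w\in C^{\kappa,\alpha}(\mathbb R)$ be complex-valued and supported in $I$, with $$|w^{(j)}(x)|\le C|I|^{-j}\quad(0\le j\le\kappa),\qquad |w^{(\kappa)}(x)-w^{(\kappa)}(y)|\le C|I|^{-\kappa-\alpha}|x-y|^\alpha\qquad (x,y\in I).$$ Let $\Lambda>0$ and let $\varphi\in C^{\kappa+1,\alpha}(I)$ be real-valued with $$|\varphi^{(j+1)}(x)|\le C\Lambda|I|^{-j}\quad(1\le j\le\kappa),\qquad |\varphi^{(\kappa+1)}(x)-\varphi^{(\kappa+1)}(y)|\le C\Lambda|I|^{-\kappa-\alpha}|x-y|^\alpha\qquad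 (x,y\in I),$$ the first condition being vacuous when $\kappa=0$. Then there is an integrable function $E_I:\mathbb R\to\mathbb C$, independent of $m$, such that for every real $m>0$ and every $x\in\mathbb R$ $$\bigl|e^{i\varphi(x)}w(x)-E_I(x)\bigr|\le K_m\,\frac{(\Lambda|I|)^{-\kappa-\alpha}}{(1+\Lambda\, d(x,I))^{m}},$$ where $d(x,I)$ is the distance from $x$ to $I$ and $e^{i\varphi}w$ is understood to be $0$ outside $I$. Moreover $\widehat{E_I}(\xi)=\int_{\mathbb R}e^{-2\pi i x\xi}E_I(x)\,dx$ vanishes at every $\xi\in\mathbb R$ with $$\inf_{x\in I}\Bigl|\xi-\frac{\varphi'(x)}{2\pi}\Bigr|>\frac{\Lambda}{4\pi}.$$ -/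

import Mathlib

open scoped FourierTransform

/-- The Hölder class `C^{n,α}(s)`: `f` is `n` times continuously differentiable on `s` and its
`n`-th derivative is Hölder continuous on `s` with exponent `α` (for `α = 0` this asks, besides
`C^n`, only that the `n`-th derivative has bounded oscillation). On `s = Set.univ` or a
nondegenerate interval `iteratedDerivWithin` is the usual (at endpoints one-sided) derivative. -/
def HolderClass {F : Type*} [NormedAddCommGroup F] [NormedSpace ℝ F]
    (n : ℕ) (α : ℝ) (s : Set ℝ) (f : ℝ → F) : Prop :=
  ContDiffOn ℝ n f s ∧
    ∃ M : ℝ, ∀ x ∈ s, ∀ y ∈ s,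
      ‖iteratedDerivWithin n f s x - iteratedDerivWithin n f s y‖ ≤ M * |x - y| ^ α

open MeasureTheory SchwartzMap

/-! Write `L = b - a` and `g = e^{iφ}w`. If `Λ L ≤ 1`, the error allowed on `I` is at least a
constant, so `E = 0` works. Otherwise `E` is `g` convolved with `Λ k(Λ ·)`, where `𝓕 k` is one near
the range `[p, q]` of `φ'/(2πΛ)` and vanishes off its `1/(4π)`-neighbourhood. Then `𝓕 E ξ = 𝓕 k
(ξ/Λ) * 𝓕 g ξ` has the required zeros, and `E` is chosen before `m`.

The error bound rests on reproduction: since `𝓕 k` is locally constant at `ξ ∈ [p, q]`, integrating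
a polynomial times `e^{-2πisξ}` against `k(s)` returns the polynomial's value at `0`
(`integral_eval_mul_exp_mul`). For `x ∈ I`, Taylor expansion of `w` and `φ`, followed by truncation
of the exponential of the phase terms of order at least two, shows that `g(x - s/Λ)` is such a
function up to `(ΛL)^{-κ-α}` times a power of `1 + |s|` (`exists_polynomial_approx`). For `x ∉ I`
the Taylor polynomial of `w` is zero, and `g(x - s/Λ) ≠ 0` forces `|s| ≥ Λ d(x, I)`, so powers of `1
+ |s|` buy decay (`norm_mul_le_of_notMem`).

Constants are uniform because `k` is dominated by `q - p + 1/(4π)`, at most `C + 1`, times one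
Schwartz function fixed before all the data. -/

/-! ### Band-limited kernels and their reproducing property. -/

/-- There is a Schwartz function whose Fourier transform is a bump of mass one
supported in the ball of radius `δ`. -/
theorem exists_schwartz_fourier_bump {δ : ℝ} (hδ : 0 < δ) :
    ∃ (r : 𝓢(ℝ, ℂ)) (ρ : ℝ → ℝ), (∀ ξ, 𝓕 (r : ℝ → ℂ) ξ = ρ ξ) ∧
      Function.support ρ ⊆ Metric.ball 0 δ ∧ ∫ x, ρ x = 1 := by
  let f : ContDiffBump (0 : ℝ) := ⟨δ / 2, δ, by positivity, by linarith⟩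
  have hc : HasCompactSupport (fun x ↦ ((f.normed volume x : ℝ) : ℂ)) :=
    (f.hasCompactSupport_normed (μ := volume)).comp_left (g := fun x : ℝ ↦ (x : ℂ)) rfl
  have hs : ContDiff ℝ (⊤ : ℕ∞) (fun x ↦ ((f.normed volume x : ℝ) : ℂ)) :=
    Complex.ofRealCLM.contDiff.comp (f.contDiff_normed)
  refine ⟨𝓕⁻ (hc.toSchwartzMap hs), f.normed volume, fun ξ ↦ ?_, ?_, ?_⟩
  · rw [← SchwartzMap.fourier_coe]
    simp
  · rw [f.support_normed_eq]
  · exact f.integral_normed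

/-- The product of `r` with the inverse Fourier transform of the indicator of `[p, q]`. -/
noncomputable def bandKernel (r : 𝓢(ℝ, ℂ)) (p q s : ℝ) : ℂ :=
  (∫ η in p..q, Complex.exp (2 * Real.pi * Complex.I * s * η)) * r s

theorem continuous_bandKernel (r : 𝓢(ℝ, ℂ)) (p q : ℝ) : Continuous (bandKernel r p q) := by
  unfold bandKernel
  refine Continuous.mul ?_ r.continuous
  exact intervalIntegral.continuous_parametric_intervalIntegral_of_continuous' (by fun_prop) _ _

theorem norm_bandKernel_le (r : 𝓢(ℝ, ℂ)) {p q : ℝ} (hpq : p ≤ q) (s : ℝ) :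
    ‖bandKernel r p q s‖ ≤ (q - p) * ‖r s‖ := by
  unfold bandKernel
  rw [norm_mul]
  gcongr
  have := intervalIntegral.norm_integral_le_of_norm_le_const (a := p) (b := q) (C := 1)
    (f := fun η : ℝ ↦ Complex.exp (2 * Real.pi * Complex.I * s * η)) (fun η _ ↦ by
      rw [Complex.norm_exp]; simp)
  rwa [one_mul, abs_of_nonneg (by linarith)] at this

theorem integrable_pow_smul_bandKernel (r : 𝓢(ℝ, ℂ)) {p q : ℝ} (hpq : p ≤ q) (n : ℕ) :
    Integrable (fun s : ℝ ↦ s ^ n • bandKernel r p q s) := by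
  refine ((r.integrable_pow_mul volume n).const_mul (q - p)).mono'
    (((continuous_pow n).smul (continuous_bandKernel r p q)).aestronglyMeasurable)
    (Filter.Eventually.of_forall fun s ↦ ?_)
  rw [norm_smul, norm_pow]
  calc ‖s‖ ^ n * ‖bandKernel r p q s‖ ≤ ‖s‖ ^ n * ((q - p) * ‖r s‖) := by
        gcongr; exact norm_bandKernel_le r hpq s
    _ = _ := by ring

/-- Multiplying by `e^{2πisη}` shifts the frequency by `η`; Fubini applies because `η` ranges over a
bounded interval and `r` is integrable. -/
theorem fourier_bandKernel (r : 𝓢(ℝ, ℂ)) (p q ξ : ℝ) :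
    𝓕 (bandKernel r p q) ξ = ∫ η in p..q, 𝓕 (r : ℝ → ℂ) (ξ - η) := by
  simp_rw [Real.fourier_real_eq_integral_exp_smul, bandKernel, smul_eq_mul]
  rw [intervalIntegral_integral_swap]
  · congr with s
    rw [mul_left_comm, ← mul_assoc, ← intervalIntegral.integral_mul_const,
      ← intervalIntegral.integral_mul_const]
    congr with η
    rw [← Complex.exp_add]
    congr 2
    push_cast
    ring
  · have : IsFiniteMeasure (volume.restrict (Set.uIoc p q)) := ⟨by simp [Set.uIoc]⟩
    have h := (integrable_const (μ := volume.restrict (Set.uIoc p q)) (1 : ℝ)).mul_prod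
      (r.integrable (μ := volume)).norm
    refine h.mono' ?_ (Filter.Eventually.of_forall fun z ↦ ?_)
    · apply Continuous.aestronglyMeasurable
      have := r.continuous
      unfold Function.uncurry
      fun_prop
    · simp only [Function.uncurry, norm_mul, one_mul, Complex.norm_exp]
      simp

/-- The integration window then contains the whole support of `ρ`, hence its full mass. -/
theorem fourier_bandKernel_eq_one {r : 𝓢(ℝ, ℂ)} {ρ : ℝ → ℝ} {δ : ℝ}
    (hr : ∀ ξ, 𝓕 (r : ℝ → ℂ) ξ = ρ ξ) (hρ : Function.support ρ ⊆ Metric.ball 0 δ)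
    (h1 : ∫ x, ρ x = 1) {p q ξ : ℝ} (hp : p + δ ≤ ξ) (hq : ξ ≤ q - δ) :
    𝓕 (bandKernel r p q) ξ = 1 := by
  rw [fourier_bandKernel]
  simp_rw [hr]
  rw [intervalIntegral.integral_ofReal, intervalIntegral.integral_comp_sub_left,
    intervalIntegral.integral_eq_integral_of_support_subset, h1, Complex.ofReal_one]
  intro x hx
  have := hρ hx
  rw [Metric.mem_ball, dist_zero_right, Real.norm_eq_abs, abs_lt] at this
  exact ⟨by linarith, by linarith⟩

theorem fourier_bandKernel_eq_zero {r : 𝓢(ℝ, ℂ)} {ρ : ℝ → ℝ} {δ : ℝ}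
    (hr : ∀ ξ, 𝓕 (r : ℝ → ℂ) ξ = ρ ξ) (hρ : Function.support ρ ⊆ Metric.ball 0 δ)
    {p q ξ : ℝ} (h : ξ ∉ Set.Icc (p - δ) (q + δ)) (hpq : p ≤ q) :
    𝓕 (bandKernel r p q) ξ = 0 := by
  rw [fourier_bandKernel]
  simp_rw [hr]
  refine intervalIntegral.integral_zero_ae (Filter.Eventually.of_forall fun η hη ↦ ?_)
  by_contra hne
  have := hρ (show ξ - η ∈ Function.support ρ from fun h0 ↦ hne (by simp [h0]))
  rw [Metric.mem_ball, dist_zero_right, Real.norm_eq_abs, abs_lt] at this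
  rw [Set.uIoc_of_le hpq] at hη
  exact h ⟨by linarith [hη.1], by linarith [hη.2]⟩

theorem integrable_eval_mul_exp_mul {k : ℝ → ℂ}
    (hk : ∀ n : ℕ, Integrable (fun s : ℝ ↦ s ^ n • k s)) (ξ : ℝ) (P : Polynomial ℂ) :
    Integrable fun s : ℝ ↦
      P.eval (s : ℂ) * Complex.exp (-(2 * Real.pi * Complex.I * s * ξ)) * k s := by
  simp_rw [Polynomial.eval_eq_sum_range, Finset.sum_mul, mul_assoc]
  refine integrable_finsetSum _ fun n _ ↦ Integrable.const_mul ?_ _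
  refine (hk n).norm.mono' ?_ (Filter.Eventually.of_forall fun s ↦ ?_)
  · have h0 : AEStronglyMeasurable k := by simpa using (hk 0).1
    exact (Continuous.aestronglyMeasurable (by fun_prop)).mul
      ((Continuous.aestronglyMeasurable (by fun_prop)).mul h0)
  · rw [norm_mul, norm_mul, Complex.norm_exp, norm_smul]
    simp

/-- If the Fourier transform of `k` is locally one at `ξ`, then integration against
`e^{-2πisξ} k(s)` evaluates polynomials at the origin. -/
theorem integral_eval_mul_exp_mul {k : ℝ → ℂ}
    (hk : ∀ n : ℕ, Integrable (fun s : ℝ ↦ s ^ n • k s)) {ξ : ℝ}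
    (h1 : 𝓕 k =ᶠ[nhds ξ] fun _ ↦ 1) (P : Polynomial ℂ) :
    ∫ s : ℝ, P.eval (s : ℂ) * Complex.exp (-(2 * Real.pi * Complex.I * s * ξ)) * k s
      = P.eval 0 := by
  -- The `n`-th derivative of `𝓕 k` at `ξ` is, up to `(-2πi)^n`, the `n`-th modulated moment of `k`;
  -- local constancy kills all but `n = 0`.
  have hmom (n : ℕ) : ∫ s : ℝ, (s : ℂ) ^ n * Complex.exp (-(2 * Real.pi * Complex.I * s * ξ)) * k s
      = if n = 0 then 1 else 0 := by
    have h := congrFun (Real.iteratedDeriv_fourier (N := ⊤) (n := n) (fun n _ ↦ hk n) le_top) ξ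
    rw [h1.iteratedDeriv_eq, iteratedDeriv_const, Real.fourier_real_eq_integral_exp_smul] at h
    have h2 : (-2 * Real.pi * Complex.I : ℂ) ^ n ≠ 0 :=
      pow_ne_zero _ (by simp [Real.pi_ne_zero])
    apply mul_left_cancel₀ h2
    rw [← integral_const_mul]
    refine (Eq.trans ?_ h.symm).trans ?_
    · congr with s
      rw [smul_eq_mul, smul_eq_mul, mul_pow (_ * _) (s : ℂ)]
      rw [show (((-2 * Real.pi * s * ξ : ℝ) : ℂ) * Complex.I)
        = -(2 * Real.pi * Complex.I * s * ξ) by push_cast; ring]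
      ring
    · split_ifs with hn <;> simp [hn]
  induction P using Polynomial.induction_on' with
  | add P Q hP hQ =>
    simp_rw [Polynomial.eval_add, add_mul]
    rw [integral_add (integrable_eval_mul_exp_mul hk ξ P) (integrable_eval_mul_exp_mul hk ξ Q), hP, hQ]
  | monomial n c =>
    simp_rw [Polynomial.eval_monomial, mul_assoc c]
    rw [integral_const_mul, hmom]
    by_cases hn : n = 0 <;> simp [hn]

/-- Convolution kernels dominated by a fixed Schwartz function which reproduce every
`polynomial × e^{2πixξ}` with `ξ ∈ [p, q]` and have spectrum in the `δ`-neighbourhood of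
`[p, q]`. -/
theorem exists_bandKernel {δ : ℝ} (hδ : 0 < δ) :
    ∃ r : 𝓢(ℝ, ℂ), ∀ p q : ℝ, p ≤ q → ∃ k : ℝ → ℂ, Integrable k ∧
      (∀ s, ‖k s‖ ≤ (q - p + δ) * ‖r s‖) ∧
      (∀ ξ ∈ Set.Icc p q, ∀ P : Polynomial ℂ,
        Integrable (fun s : ℝ ↦
          P.eval (s : ℂ) * Complex.exp (-(2 * Real.pi * Complex.I * s * ξ)) * k s) ∧
        ∫ s : ℝ, P.eval (s : ℂ) * Complex.exp (-(2 * Real.pi * Complex.I * s * ξ)) * k s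
          = P.eval 0) ∧
      ∀ ξ ∉ Set.Icc (p - δ) (q + δ), 𝓕 k ξ = 0 := by
  obtain ⟨r, ρ, hr, hρ, h1⟩ := exists_schwartz_fourier_bump (δ := δ / 4) (by positivity)
  refine ⟨r, fun p q hpq ↦ ?_⟩
  have hpq' : p - δ / 2 ≤ q + δ / 2 := by linarith
  -- Widening by `δ/2` with a bump of radius `δ/4` makes the transform one on the
  -- `δ/4`-neighbourhood of `[p, q]` and zero off the `3δ/4`-neighbourhood.
  refine ⟨bandKernel r (p - δ / 2) (q + δ / 2), ?_, fun s ↦ ?_,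
    fun ξ hξ P ↦ ?_, fun ξ hξ ↦ ?_⟩
  · simpa using integrable_pow_smul_bandKernel r hpq' 0
  · convert norm_bandKernel_le r hpq' s using 2
    ring
  · refine ⟨integrable_eval_mul_exp_mul (fun n ↦ integrable_pow_smul_bandKernel r hpq' n) ξ P,
      integral_eval_mul_exp_mul (fun n ↦ integrable_pow_smul_bandKernel r hpq' n) ?_ P⟩
    have hmem : Set.Icc (p - δ / 4) (q + δ / 4) ∈ nhds ξ :=
      Icc_mem_nhds (by linarith [hξ.1]) (by linarith [hξ.2])
    filter_upwards [hmem] with η hη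
    exact fourier_bandKernel_eq_one hr hρ h1 (by linarith [hη.1]) (by linarith [hη.2])
  · refine fourier_bandKernel_eq_zero hr hρ (fun h ↦ hξ ?_) hpq'
    exact ⟨by linarith [h.1], by linarith [h.2]⟩

/-! ### Taylor expansion with Hölder remainder. -/

/-- Taylor's formula with a Hölder bound on the last derivative, for a sequence of successive
derivatives. -/
theorem norm_sub_taylor_sum_le {F : Type*} [NormedAddCommGroup F] [NormedSpace ℝ F]
    {S : Set ℝ} (hS : Convex ℝ S) {α M : ℝ} (hα : 0 ≤ α) (hM : 0 ≤ M) {x : ℝ} (hx : x ∈ S)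
    (n : ℕ) (f : ℕ → ℝ → F)
    (hf : ∀ j < n, ∀ y ∈ S, HasDerivWithinAt (f j) (f (j + 1) y) S y)
    (hn : ∀ y ∈ S, ‖f n y - f n x‖ ≤ M * |y - x| ^ α) :
    ∀ y ∈ S, ‖f 0 y - ∑ j ∈ Finset.range (n + 1), ((y - x) ^ j / j.factorial) • f j x‖
      ≤ M * |y - x| ^ (n + α) := by
  induction n generalizing f with
  | zero => intro y hy; simpa using hn y hy
  | succ n ih =>
    intro y hy
    have ih' := ih (fun j ↦ f (j + 1)) (fun j hj ↦ hf (j + 1) (by omega)) hn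
    have hsub : Set.uIcc x y ⊆ S := hS.ordConnected.uIcc_subset hx hy
    -- The derivative of the remainder is the remainder of one order less for the shifted sequence;
    -- the mean value inequality on the segment from `x` to `y` gains a factor `|y - x|`.
    let g : ℝ → F := fun z ↦
      f 0 z - ∑ j ∈ Finset.range (n + 1 + 1), ((z - x) ^ j / j.factorial) • f j x
    have hg : ∀ z ∈ Set.uIcc x y, HasDerivWithinAt g
        (f 1 z - ∑ j ∈ Finset.range (n + 1), ((z - x) ^ j / j.factorial) • f (j + 1) x)
        (Set.uIcc x y) z := by
      intro z hz
      refine ((hf 0 (by omega) z (hsub hz)).mono hsub).sub ?_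
      simp_rw [Finset.sum_range_succ' _ (n + 1)]
      simp only [pow_zero, Nat.factorial_zero]
      refine (HasDerivAt.add_const _ ?_).hasDerivWithinAt
      refine HasDerivAt.fun_sum fun j _ ↦ HasDerivAt.smul_const ?_ _
      have h := (((hasDerivAt_id' z).sub_const x).fun_pow (j + 1)).div_const
        (((j + 1).factorial : ℕ) : ℝ)
      convert h using 1
      have h0 : (((j + 1).factorial : ℕ) : ℝ) = (j + 1) * j.factorial := by
        rw [Nat.factorial_succ]; push_cast; ring
      rw [h0, Nat.add_sub_cancel, mul_one]
      push_cast
      field_simp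
    have hb : ∀ z ∈ Set.uIcc x y,
        ‖f 1 z - ∑ j ∈ Finset.range (n + 1), ((z - x) ^ j / j.factorial) • f (j + 1) x‖
          ≤ M * |y - x| ^ (n + α) := by
      intro z hz
      refine (ih' z (hsub hz)).trans ?_
      exact mul_le_mul_of_nonneg_left (Real.rpow_le_rpow (abs_nonneg _)
        (Set.abs_sub_left_of_mem_uIcc hz) (by positivity)) hM
    have h := (convex_uIcc x y).norm_image_sub_le_of_norm_hasDerivWithin_le hg hb
      Set.left_mem_uIcc Set.right_mem_uIcc
    have hgx : g x = 0 := by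
      simp only [g, Finset.sum_range_succ' _ (n + 1)]
      simp
    rw [hgx, sub_zero] at h
    refine h.trans (le_of_eq ?_)
    rw [Real.norm_eq_abs, mul_assoc]
    congr 1
    push_cast
    rw [add_right_comm, Real.rpow_add_one' (abs_nonneg _) (by positivity)]

/-- Taylor's formula in the Hölder class. -/
theorem ContDiffOn.norm_sub_taylor_sum_le {F : Type*} [NormedAddCommGroup F] [NormedSpace ℝ F]
    {S : Set ℝ} (hS : Convex ℝ S) (hS' : UniqueDiffOn ℝ S) {α M : ℝ} (hα : 0 ≤ α) (hM : 0 ≤ M)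
    {x : ℝ} (hx : x ∈ S) {n : ℕ} {f : ℝ → F} (hf : ContDiffOn ℝ n f S)
    (hn : ∀ y ∈ S, ‖iteratedDerivWithin n f S y - iteratedDerivWithin n f S x‖
      ≤ M * |y - x| ^ α) {y : ℝ} (hy : y ∈ S) :
    ‖f y - ∑ j ∈ Finset.range (n + 1), ((y - x) ^ j / j.factorial) • iteratedDerivWithin j f S x‖
      ≤ M * |y - x| ^ (n + α) := by
  have h := _root_.norm_sub_taylor_sum_le hS hα hM hx n (fun j ↦ iteratedDerivWithin j f S)
    (fun j hj z hz ↦ ?_) hn y hy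
  · simpa only [iteratedDerivWithin_zero] using h
  · rw [iteratedDerivWithin_succ]
    exact (hf.differentiableOn_iteratedDerivWithin (mod_cast hj) hS' z hz).hasDerivWithinAt

/-- Each derivative of `e^{iy}` is 1-Lipschitz, so the Taylor bound applies with `α = 1` and `M =
1`. -/
theorem norm_exp_I_mul_sub_sum_le (n : ℕ) (x : ℝ) :
    ‖Complex.exp (Complex.I * x) - ∑ j ∈ Finset.range (n + 1), (Complex.I * x) ^ j / j.factorial‖
      ≤ |x| ^ (n + 1) := by
  have hd (z : ℝ) : HasDerivAt (fun y : ℝ ↦ Complex.exp (Complex.I * y))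
      (Complex.I * Complex.exp (Complex.I * z)) z := by
    have h := ((Complex.ofRealCLM.hasDerivAt (x := z)).const_mul Complex.I).cexp
    simpa [mul_comm] using h
  have hl (y : ℝ) : ‖Complex.exp (Complex.I * y) - Complex.exp (Complex.I * (0 : ℝ))‖
      ≤ 1 * |y - 0| := by
    have h := convex_univ.norm_image_sub_le_of_norm_hasDerivWithin_le (C := 1)
      (fun z _ ↦ (hd z).hasDerivWithinAt) (fun z _ ↦ by simp [Complex.norm_exp])
      (Set.mem_univ (0 : ℝ)) (Set.mem_univ y)
    simpa using h
  have h := norm_sub_taylor_sum_le (F := ℂ) convex_univ zero_le_one zero_le_one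
    (Set.mem_univ (0 : ℝ)) n
    (fun j y ↦ Complex.I ^ j * Complex.exp (Complex.I * y))
    (fun j _ z _ ↦ by
      rw [pow_succ, mul_assoc]; exact ((hd z).const_mul _).hasDerivWithinAt)
    (fun y _ ↦ by
      rw [← mul_sub, norm_mul, norm_pow, Complex.norm_I, one_pow, one_mul, Real.rpow_one]
      exact hl y) x (Set.mem_univ x)
  rw [sub_zero, one_mul] at h
  convert h using 1
  · congr 1
    simp only [pow_zero, one_mul, Complex.ofReal_zero, mul_zero, Complex.exp_zero, mul_one,
      Complex.real_smul]
    congr 1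
    refine Finset.sum_congr rfl fun j _ ↦ ?_
    push_cast
    ring
  · exact_mod_cast (Real.rpow_natCast _ _).symm

theorem iteratedDeriv_eq_zero_of_support_subset_Icc {F : Type*} [NormedAddCommGroup F]
    [NormedSpace ℝ F] {f : ℝ → F} {a b : ℝ} (hs : Function.support f ⊆ Set.Icc a b) (n : ℕ)
    {z : ℝ} (hz : z ∉ Set.Icc a b) : iteratedDeriv n f z = 0 := by
  have h : z ∉ Function.support (iteratedFDeriv ℝ n f) := fun h ↦
    hz (closure_minimal hs isClosed_Icc (support_iteratedFDeriv_subset n h))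
  rw [iteratedDeriv, Function.notMem_support.1 h]
  rfl

/-- A Hölder bound for the last derivative on an interval containing the support is global. -/
theorem norm_iteratedDeriv_sub_le_of_support_subset_Icc {F : Type*} [NormedAddCommGroup F]
    [NormedSpace ℝ F] {n : ℕ} {f : ℝ → F} {a b α M : ℝ} (hab : a < b) (hα : 0 ≤ α) (hM : 0 ≤ M)
    (hf : ContDiff ℝ n f) (hs : Function.support f ⊆ Set.Icc a b)
    (h : ∀ x ∈ Set.Icc a b, ∀ y ∈ Set.Icc a b,
      ‖iteratedDeriv n f x - iteratedDeriv n f y‖ ≤ M * |x - y| ^ α) (x y : ℝ) :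
    ‖iteratedDeriv n f x - iteratedDeriv n f y‖ ≤ M * |x - y| ^ α := by
  have hcont : Continuous (iteratedDeriv n f) := hf.continuous_iteratedDeriv n le_rfl
  have hzero {s : Set ℝ} (hsub : s ⊆ (Set.Icc a b)ᶜ) {z : ℝ} (hz : z ∈ closure s) :
      iteratedDeriv n f z = 0 :=
    Set.EqOn.closure (f := iteratedDeriv n f) (g := fun _ ↦ 0)
      (fun u hu ↦ iteratedDeriv_eq_zero_of_support_subset_Icc hs n (hsub hu)) hcont
      continuous_const hz
  have ha : ∀ z ≤ a, iteratedDeriv n f z = 0 := fun z hz ↦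
    hzero (s := Set.Iio a) (fun u (hu : u < a) hu' ↦ absurd hu'.1 (by linarith))
      (by rwa [closure_Iio])
  have hb : ∀ z, b ≤ z → iteratedDeriv n f z = 0 := fun z hz ↦
    hzero (s := Set.Ioi b) (fun u (hu : b < u) hu' ↦ absurd hu'.2 (by linarith))
      (by rwa [closure_Ioi])
  -- By continuity the derivative vanishes at `a` and `b`, so clamping to `[a, b]` leaves it
  -- unchanged; clamping is also 1-Lipschitz.
  have hproj (z : ℝ) : iteratedDeriv n f z = iteratedDeriv n f (Set.projIcc a b hab.le z) := by
    rcases le_total z a with hz | hz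
    · rw [ha z hz, Set.projIcc_of_le_left _ hz, ha a le_rfl]
    rcases le_total b z with hz' | hz'
    · rw [hb z hz', Set.projIcc_of_right_le _ hz', hb b le_rfl]
    · rw [Set.projIcc_of_mem _ ⟨hz, hz'⟩]
  rw [hproj x, hproj y]
  refine (h _ (Set.projIcc a b hab.le x).2 _ (Set.projIcc a b hab.le y).2).trans ?_
  exact mul_le_mul_of_nonneg_left (Real.rpow_le_rpow (abs_nonneg _)
    (Set.abs_projIcc_sub_projIcc hab.le) hα) hM

/-! ### Polynomial models at scale `1/Λ`, for `Λ L ≥ 1`. -/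

theorem abs_neg_div_pow_mul_div_le {s L Λ : ℝ} (hL : 0 < L) (hΛ : 0 < Λ) (hR : 1 ≤ Λ * L)
    (j : ℕ) : |-(s / Λ)| ^ j / L ^ j ≤ |s| ^ j := by
  rw [abs_neg, abs_div, abs_of_pos hΛ, ← div_pow, div_div]
  gcongr
  exact div_le_self (abs_nonneg s) hR

/-- Bound for a Taylor polynomial with natural bounds on its coefficients. -/
theorem norm_taylor_sum_le {κ : ℕ} {C L Λ : ℝ} (hC : 0 ≤ C) (hL : 0 < L) (hΛ : 0 < Λ)
    (hR : 1 ≤ Λ * L) {W : ℕ → ℂ} (hW : ∀ j ≤ κ, ‖W j‖ ≤ C / L ^ j) (s : ℝ) :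
    ‖∑ j ∈ Finset.range (κ + 1), ((-(s / Λ)) ^ j / j.factorial : ℝ) • W j‖
      ≤ (κ + 1) * C * (1 + |s|) ^ κ := by
  refine (norm_sum_le _ _).trans ?_
  have hterm : ∀ j ∈ Finset.range (κ + 1),
      ‖((-(s / Λ)) ^ j / j.factorial : ℝ) • W j‖ ≤ C * (1 + |s|) ^ κ := by
    intro j hj
    have hj' : j ≤ κ := Nat.lt_succ_iff.1 (Finset.mem_range.1 hj)
    have hf : (1 : ℝ) ≤ j.factorial := by exact_mod_cast Nat.one_le_iff_ne_zero.2 j.factorial_ne_zero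
    rw [norm_smul, norm_div, norm_pow, Real.norm_eq_abs, Real.norm_natCast]
    calc |-(s / Λ)| ^ j / j.factorial * ‖W j‖ ≤ |-(s / Λ)| ^ j / 1 * (C / L ^ j) := by
          gcongr
          exact hW j hj'
      _ = C * (|-(s / Λ)| ^ j / L ^ j) := by ring
      _ ≤ C * |s| ^ j := by
          gcongr
          exact abs_neg_div_pow_mul_div_le hL hΛ hR j
      _ ≤ C * (1 + |s|) ^ j := by gcongr; linarith
      _ ≤ C * (1 + |s|) ^ κ := by
          gcongr
          linarith [abs_nonneg s]
  refine (Finset.sum_le_card_nsmul _ _ _ hterm).trans (le_of_eq ?_)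
  rw [Finset.card_range, nsmul_eq_mul]
  push_cast
  ring

/-- The part of a Taylor polynomial of the phase of order at least two is small. -/
theorem abs_phase_tail_le {κ : ℕ} {C L Λ : ℝ} (hC : 0 ≤ C) (hL : 0 < L) (hΛ : 0 < Λ)
    (hR : 1 ≤ Λ * L) {Φ : ℕ → ℝ} (hΦ : ∀ j, 1 ≤ j → j ≤ κ → |Φ (j + 1)| ≤ C * Λ / L ^ j) (s : ℝ) :
    |∑ i ∈ Finset.range κ, (-(s / Λ)) ^ (i + 2) / (i + 2).factorial * Φ (i + 2)|
      ≤ κ * C * (Λ * L)⁻¹ * (1 + |s|) ^ (κ + 1) := by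
  refine (Finset.abs_sum_le_sum_abs _ _).trans ?_
  have hterm : ∀ i ∈ Finset.range κ,
      |(-(s / Λ)) ^ (i + 2) / (i + 2).factorial * Φ (i + 2)|
        ≤ C * (Λ * L)⁻¹ * (1 + |s|) ^ (κ + 1) := by
    intro i hi
    have hi' : i + 1 ≤ κ := Finset.mem_range.1 hi
    have hf : (1 : ℝ) ≤ (i + 2).factorial := by
      exact_mod_cast Nat.one_le_iff_ne_zero.2 (i + 2).factorial_ne_zero
    rw [abs_mul, abs_div, abs_pow, Nat.abs_cast]
    calc |-(s / Λ)| ^ (i + 2) / (i + 2).factorial * |Φ (i + 2)|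
        ≤ |-(s / Λ)| ^ (i + 2) / 1 * (C * Λ / L ^ (i + 1)) := by
          gcongr
          exact hΦ (i + 1) (by omega) hi'
      -- Two factors of `|s / Λ|` and one of `1 / L` are set aside to produce `(Λ L)⁻¹`; the
      -- remaining `i` pairs cost only `|s| ^ i`.
      _ = C * (Λ * |-(s / Λ)| / L ^ 1) * |-(s / Λ)| * (|-(s / Λ)| ^ i / L ^ i) := by
          field_simp
          ring
      _ ≤ C * (Λ * |-(s / Λ)| / L ^ 1) * |-(s / Λ)| * |s| ^ i := by
          gcongr
          exact abs_neg_div_pow_mul_div_le hL hΛ hR i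
      _ = C * (Λ * L)⁻¹ * |s| ^ (i + 2) := by
          rw [abs_neg, abs_div, abs_of_pos hΛ]
          field_simp
          ring
      _ ≤ C * (Λ * L)⁻¹ * (1 + |s|) ^ (i + 2) := by gcongr; linarith
      _ ≤ C * (Λ * L)⁻¹ * (1 + |s|) ^ (κ + 1) := by
          have := abs_nonneg s
          exact mul_le_mul_of_nonneg_left (pow_le_pow_right₀ (by linarith) (by omega))
            (by positivity)
  refine (Finset.sum_le_card_nsmul _ _ _ hterm).trans (le_of_eq ?_)
  rw [Finset.card_range, nsmul_eq_mul]
  ring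

/-- The product of a Taylor polynomial with the exponential of the Taylor polynomial of the phase
is close to a polynomial times a pure exponential. -/
theorem exists_polynomial_mul_exp_approx {κ : ℕ} {C L Λ : ℝ} (hC : 0 ≤ C) (hL : 0 < L) (hΛ : 0 < Λ)
    (hR : 1 ≤ Λ * L) {W : ℕ → ℂ} (hW : ∀ j ≤ κ, ‖W j‖ ≤ C / L ^ j)
    {Φ : ℕ → ℝ} (hΦ : ∀ j, 1 ≤ j → j ≤ κ → |Φ (j + 1)| ≤ C * Λ / L ^ j) :
    ∃ P : Polynomial ℂ, P.eval 0 = Complex.exp (Complex.I * Φ 0) * W 0 ∧ ∀ s : ℝ,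
      ‖Complex.exp (Complex.I *
            (∑ j ∈ Finset.range (κ + 1 + 1), (-(s / Λ)) ^ j / j.factorial * Φ j : ℝ)) *
          (∑ j ∈ Finset.range (κ + 1), ((-(s / Λ)) ^ j / j.factorial : ℝ) • W j)
        - P.eval (s : ℂ) *
          Complex.exp (-(2 * Real.pi * Complex.I * s * (Φ 1 / (2 * Real.pi * Λ) : ℝ)))‖
      ≤ (κ + 1) * C * (κ * C) ^ (κ + 1) * (Λ * L)⁻¹ ^ (κ + 1)
          * (1 + |s|) ^ (κ + (κ + 1) * (κ + 1)) := by
  let Wp : Polynomial ℂ := ∑ j ∈ Finset.range (κ + 1),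
    Polynomial.C ((-Λ⁻¹ : ℂ) ^ j / j.factorial * W j) * Polynomial.X ^ j
  let Qp : Polynomial ℂ := ∑ i ∈ Finset.range κ,
    Polynomial.C ((-Λ⁻¹ : ℂ) ^ (i + 2) / (i + 2).factorial * Φ (i + 2)) * Polynomial.X ^ (i + 2)
  -- Stopping at order `κ` suffices: `Qp` has size `(ΛL)⁻¹` up to powers of `1 + |s|`, so the
  -- exponential's remainder carries `(ΛL)⁻¹ ^ (κ + 1)`.
  let Ep : Polynomial ℂ := ∑ l ∈ Finset.range (κ + 1),
    Polynomial.C ((l.factorial : ℂ)⁻¹) * (Polynomial.C Complex.I * Qp) ^ l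
  have hWp (s : ℝ) : Wp.eval (s : ℂ)
      = ∑ j ∈ Finset.range (κ + 1), ((-(s / Λ)) ^ j / j.factorial : ℝ) • W j := by
    simp only [Wp, Polynomial.eval_finsetSum, Polynomial.eval_mul, Polynomial.eval_C,
      Polynomial.eval_pow, Polynomial.eval_X, Complex.real_smul]
    refine Finset.sum_congr rfl fun j _ ↦ ?_
    push_cast
    rw [show (-(s / Λ) : ℂ) = -(Λ : ℂ)⁻¹ * s by ring, mul_pow]
    ring
  have hQp (s : ℝ) : Qp.eval (s : ℂ)
      = (∑ i ∈ Finset.range κ, (-(s / Λ)) ^ (i + 2) / (i + 2).factorial * Φ (i + 2) : ℝ) := by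
    simp only [Qp, Polynomial.eval_finsetSum, Polynomial.eval_mul, Polynomial.eval_C,
      Polynomial.eval_pow, Polynomial.eval_X]
    push_cast
    refine Finset.sum_congr rfl fun j _ ↦ ?_
    rw [show (-(s / Λ) : ℂ) = -(Λ : ℂ)⁻¹ * s by ring, mul_pow]
    ring
  have hEp (z : ℂ) : Ep.eval z
      = ∑ l ∈ Finset.range (κ + 1), (Complex.I * Qp.eval z) ^ l / l.factorial := by
    simp only [Ep, Polynomial.eval_finsetSum, Polynomial.eval_mul, Polynomial.eval_C,
      Polynomial.eval_pow]
    exact Finset.sum_congr rfl fun j _ ↦ by ring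
  refine ⟨Polynomial.C (Complex.exp (Complex.I * Φ 0)) * Wp * Ep, ?_, fun s ↦ ?_⟩
  · have hW0 : Wp.eval 0 = W 0 := by
      have := hWp 0
      rw [Complex.ofReal_zero] at this
      rw [this, Finset.sum_range_succ']
      simp
    have hQ0 : Qp.eval 0 = 0 := by
      simp [Qp, Polynomial.eval_finsetSum]
    have hE0 : Ep.eval 0 = 1 := by
      rw [hEp, hQ0, Finset.sum_range_succ']
      simp
    simp [hW0, hE0]
  · have hphase : (∑ j ∈ Finset.range (κ + 1 + 1), (-(s / Λ)) ^ j / j.factorial * Φ j : ℝ)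
        = Φ 0 - s / Λ * Φ 1
          + ∑ i ∈ Finset.range κ, (-(s / Λ)) ^ (i + 2) / (i + 2).factorial * Φ (i + 2) := by
      rw [Finset.sum_range_succ', Finset.sum_range_succ']
      simp only [add_assoc, one_add_one_eq_two]
      simp
      ring
    have hlin : Complex.exp (-(2 * Real.pi * Complex.I * s * (Φ 1 / (2 * Real.pi * Λ) : ℝ)))
        = Complex.exp (((-(s / Λ * Φ 1) : ℝ) : ℂ) * Complex.I) := by
      congr 1
      have : (Real.pi : ℂ) ≠ 0 := by exact_mod_cast Real.pi_ne_zero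
      push_cast
      field_simp
    have hQb := abs_phase_tail_le hC hL hΛ hR hΦ s
    have hWb := norm_taylor_sum_le hC hL hΛ hR hW s
    rw [← hWp] at hWb ⊢
    rw [hphase, hlin]
    set q := ∑ i ∈ Finset.range κ, (-(s / Λ)) ^ (i + 2) / (i + 2).factorial * Φ (i + 2) with hq
    have hsplit : Complex.exp (Complex.I * (Φ 0 - s / Λ * Φ 1 + q : ℝ))
        = Complex.exp ((Φ 0 : ℂ) * Complex.I) * Complex.exp (((-(s / Λ * Φ 1) : ℝ) : ℂ) * Complex.I)
          * Complex.exp (Complex.I * q) := by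
      rw [← Complex.exp_add, ← Complex.exp_add]
      congr 1
      push_cast
      ring
    have hid : Complex.exp (Complex.I * (Φ 0 - s / Λ * Φ 1 + q : ℝ)) * Wp.eval (s : ℂ)
        - (Polynomial.C (Complex.exp (Complex.I * Φ 0)) * Wp * Ep).eval (s : ℂ) *
          Complex.exp (((-(s / Λ * Φ 1) : ℝ) : ℂ) * Complex.I)
        = Complex.exp ((Φ 0 : ℂ) * Complex.I)
          * Complex.exp (((-(s / Λ * Φ 1) : ℝ) : ℂ) * Complex.I) * Wp.eval (s : ℂ) *
          (Complex.exp (Complex.I * q)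
            - ∑ l ∈ Finset.range (κ + 1), (Complex.I * q) ^ l / l.factorial) := by
      rw [hsplit, Polynomial.eval_mul, Polynomial.eval_mul, Polynomial.eval_C, hEp, hQp, ← hq,
        mul_comm Complex.I (Φ 0 : ℂ)]
      ring
    rw [hid, norm_mul, norm_mul, norm_mul, Complex.norm_exp_ofReal_mul_I,
      Complex.norm_exp_ofReal_mul_I, one_mul, one_mul]
    calc _ ≤ (κ + 1) * C * (1 + |s|) ^ κ * |q| ^ (κ + 1) := by
          gcongr
          exact norm_exp_I_mul_sub_sum_le κ q
      _ ≤ (κ + 1) * C * (1 + |s|) ^ κ *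
          (κ * C * (Λ * L)⁻¹ * (1 + |s|) ^ (κ + 1)) ^ (κ + 1) := by gcongr
      _ = _ := by
          rw [mul_pow, mul_pow, ← pow_mul (1 + |s|), pow_add (1 + |s|) κ ((κ + 1) * (κ + 1))]
          ring

/-! ### Amplitude and phase with scaled bounds. -/

/-- An amplitude `w` supported in `[a, b]` and a phase `φ` on `[a, b]` with the natural scaled
bounds on their derivatives. -/
structure OscillatoryData (κ : ℕ) (α C a b : ℝ) (w : ℝ → ℂ) (φ : ℝ → ℝ) (Λ : ℝ) : Prop where
  lt : a < b
  Λ_pos : 0 < Λ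
  C_nonneg : 0 ≤ C
  α_nonneg : 0 ≤ α
  α_le_one : α ≤ 1
  contDiff : ContDiff ℝ κ w
  support_subset : Function.support w ⊆ Set.Icc a b
  norm_deriv_le : ∀ j ≤ κ, ∀ x ∈ Set.Icc a b, ‖iteratedDeriv j w x‖ ≤ C / (b - a) ^ j
  norm_deriv_sub_le : ∀ x ∈ Set.Icc a b, ∀ y ∈ Set.Icc a b,
    ‖iteratedDeriv κ w x - iteratedDeriv κ w y‖ ≤ C * (b - a) ^ (-(κ : ℝ) - α) * |x - y| ^ α
  contDiffOn : ContDiffOn ℝ (κ + 1 : ℕ) φ (Set.Icc a b)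
  abs_deriv_le : ∀ j, 1 ≤ j → j ≤ κ → ∀ x ∈ Set.Icc a b,
    |iteratedDerivWithin (j + 1) φ (Set.Icc a b) x| ≤ C * Λ / (b - a) ^ j
  abs_deriv_sub_le : ∀ x ∈ Set.Icc a b, ∀ y ∈ Set.Icc a b,
    |iteratedDerivWithin (κ + 1) φ (Set.Icc a b) x - iteratedDerivWithin (κ + 1) φ (Set.Icc a b) y|
      ≤ C * Λ * (b - a) ^ (-(κ : ℝ) - α) * |x - y| ^ α

theorem rpow_neg_mul_rpow_div {L Λ s : ℝ} (hL : 0 < L) (hΛ : 0 < Λ) (κ : ℕ) (α : ℝ) :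
    L ^ (-(κ : ℝ) - α) * |-(s / Λ)| ^ (κ + α) = (Λ * L) ^ (-(κ : ℝ) - α) * |s| ^ (κ + α) := by
  rw [abs_neg, abs_div, abs_of_pos hΛ, Real.div_rpow (abs_nonneg _) hΛ.le,
    Real.mul_rpow hΛ.le hL.le, show -(κ : ℝ) - α = -(κ + α) by ring, Real.rpow_neg hΛ.le]
  ring

theorem abs_rpow_le_one_add_pow {α : ℝ} (hα : 0 ≤ α) (hα' : α ≤ 1) (κ : ℕ) (s : ℝ) :
    |s| ^ (κ + α) ≤ (1 + |s|) ^ (κ + 1) := by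
  have h0 := abs_nonneg s
  calc |s| ^ (κ + α) ≤ (1 + |s|) ^ (κ + α) := by gcongr; linarith
    _ ≤ (1 + |s|) ^ ((κ + 1 : ℕ) : ℝ) := by
        refine Real.rpow_le_rpow_of_exponent_le (by linarith) ?_
        push_cast
        linarith
    _ = _ := Real.rpow_natCast _ _

namespace OscillatoryData

variable {κ : ℕ} {α C a b : ℝ} {w : ℝ → ℂ} {φ : ℝ → ℝ} {Λ : ℝ}

theorem length_pos (h : OscillatoryData κ α C a b w φ Λ) : 0 < b - a := sub_pos.2 h.lt

theorem hoelder_nonneg (h : OscillatoryData κ α C a b w φ Λ) :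
    0 ≤ C * (b - a) ^ (-(κ : ℝ) - α) :=
  mul_nonneg h.C_nonneg (Real.rpow_nonneg h.length_pos.le _)

theorem eq_zero (h : OscillatoryData κ α C a b w φ Λ) {x : ℝ} (hx : x ∉ Set.Icc a b) : w x = 0 :=
  Function.notMem_support.1 fun hx' ↦ hx (h.support_subset hx')

theorem norm_le (h : OscillatoryData κ α C a b w φ Λ) (x : ℝ) : ‖w x‖ ≤ C := by
  by_cases hx : x ∈ Set.Icc a b
  · simpa using h.norm_deriv_le 0 (Nat.zero_le _) x hx
  · simpa [h.eq_zero hx] using h.C_nonneg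

/-- Nothing is known of `φ` off `[a, b]`, but `w` vanishes there, so `φ` may be replaced by its
constant extension beyond the endpoints. -/
theorem continuous_mul (h : OscillatoryData κ α C a b w φ Λ) :
    Continuous fun x ↦ Complex.exp (Complex.I * (φ x : ℂ)) * w x := by
  have hφ : Continuous (Set.IccExtend h.lt.le ((Set.Icc a b).domRestrict φ)) :=
    (continuousOn_iff_continuous_domRestrict.1 h.contDiffOn.continuousOn).Icc_extend'
  have hw := h.contDiff.continuous
  have : (fun x ↦ Complex.exp (Complex.I * (φ x : ℂ)) * w x) = fun x ↦
      Complex.exp (Complex.I * (Set.IccExtend h.lt.le ((Set.Icc a b).domRestrict φ) x : ℝ)) * w x := by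
    ext x
    by_cases hx : x ∈ Set.Icc a b
    · rw [Set.IccExtend_of_mem _ _ hx]
      rfl
    · simp [h.eq_zero hx]
  rw [this]
  fun_prop

theorem integrable_mul (h : OscillatoryData κ α C a b w φ Λ) :
    Integrable fun x ↦ Complex.exp (Complex.I * (φ x : ℂ)) * w x :=
  h.continuous_mul.integrable_of_hasCompactSupport
    (HasCompactSupport.intro (isCompact_Icc (a := a) (b := b)) fun x hx ↦ by simp [h.eq_zero hx])

theorem norm_mul_eq (x : ℝ) : ‖Complex.exp (Complex.I * (φ x : ℂ)) * w x‖ = ‖w x‖ := by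
  rw [norm_mul, mul_comm Complex.I, Complex.norm_exp_ofReal_mul_I, one_mul]

/-- The Hölder bound for `w` is global, so `x` may lie outside the interval; this is what the decay
estimate needs. -/
theorem norm_sub_taylor_le (h : OscillatoryData κ α C a b w φ Λ) (x s : ℝ) :
    ‖w (x - s / Λ) - ∑ j ∈ Finset.range (κ + 1),
        ((-(s / Λ)) ^ j / j.factorial) • iteratedDeriv j w x‖
      ≤ C * (Λ * (b - a)) ^ (-(κ : ℝ) - α) * |s| ^ (κ + α) := by
  have hT := ContDiffOn.norm_sub_taylor_sum_le convex_univ uniqueDiffOn_univ h.α_nonneg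
    h.hoelder_nonneg (Set.mem_univ x) (contDiffOn_univ.2 h.contDiff) (fun y _ ↦ by
      rw [iteratedDerivWithin_univ]
      exact norm_iteratedDeriv_sub_le_of_support_subset_Icc h.lt h.α_nonneg h.hoelder_nonneg
        h.contDiff h.support_subset h.norm_deriv_sub_le y x) (Set.mem_univ (x - s / Λ))
  simp only [iteratedDerivWithin_univ, sub_sub_cancel_left] at hT
  rwa [mul_assoc, rpow_neg_mul_rpow_div h.length_pos h.Λ_pos, ← mul_assoc] at hT

theorem abs_phase_sub_taylor_le (h : OscillatoryData κ α C a b w φ Λ) {x s : ℝ}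
    (hx : x ∈ Set.Icc a b) (hs : x - s / Λ ∈ Set.Icc a b) :
    |φ (x - s / Λ) - ∑ j ∈ Finset.range (κ + 1 + 1),
        (-(s / Λ)) ^ j / j.factorial * iteratedDerivWithin j φ (Set.Icc a b) x|
      ≤ C * (Λ * (b - a)) ^ (-(κ : ℝ) - α) * |s| ^ (κ + α) * |s| := by
  have hα := h.α_nonneg
  have hΛ := h.Λ_pos
  have hT := ContDiffOn.norm_sub_taylor_sum_le (convex_Icc a b) (uniqueDiffOn_Icc h.lt) hα
    (M := C * Λ * (b - a) ^ (-(κ : ℝ) - α))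
    (by have := mul_nonneg hΛ.le h.hoelder_nonneg; linarith) hx h.contDiffOn
    (fun y hy ↦ h.abs_deriv_sub_le y hy x hx) hs
  simp only [sub_sub_cancel_left, smul_eq_mul, Real.norm_eq_abs] at hT
  refine hT.trans (le_of_eq ?_)
  rw [show (((κ + 1 : ℕ) : ℝ) + α) = (κ + α) + 1 by push_cast; ring,
    Real.rpow_add_one' (abs_nonneg _) (by positivity)]
  have := rpow_neg_mul_rpow_div (s := s) h.length_pos hΛ κ α
  have h1 : |-(s / Λ)| * Λ = |s| := by
    rw [abs_neg, abs_div, abs_of_pos hΛ]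
    field_simp
  linear_combination (C * Λ * |-(s / Λ)|) * this
    + (C * (Λ * (b - a)) ^ (-(κ : ℝ) - α) * |s| ^ (κ + α)) * h1

end OscillatoryData

/-! ### Local approximation on the interval and decay off it. -/

/-- Constant in the local approximation. -/
noncomputable def approxConst (κ : ℕ) (C : ℝ) : ℝ := C + C * C + (κ + 1) * C * (κ * C) ^ (κ + 1)

theorem le_approxConst (κ : ℕ) {C : ℝ} (hC : 0 ≤ C) : C ≤ approxConst κ C := by
  unfold approxConst
  have : 0 ≤ C * C + (κ + 1) * C * (κ * C) ^ (κ + 1) := by positivity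
  linarith

namespace OscillatoryData

variable {κ : ℕ} {α C a b : ℝ} {w : ℝ → ℂ} {φ : ℝ → ℝ} {Λ : ℝ}

/-- Near a point of the interval `e^{iφ}w` is close to a polynomial times a pure exponential. -/
theorem exists_polynomial_approx (h : OscillatoryData κ α C a b w φ Λ) (hR : 1 ≤ Λ * (b - a))
    {x : ℝ} (hx : x ∈ Set.Icc a b) :
    ∃ P : Polynomial ℂ, P.eval 0 = Complex.exp (Complex.I * (φ x : ℂ)) * w x ∧ ∀ s : ℝ,
      ‖Complex.exp (Complex.I * (φ (x - s / Λ) : ℂ)) * w (x - s / Λ) - P.eval (s : ℂ) *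
          Complex.exp (-(2 * Real.pi * Complex.I * s *
            (derivWithin φ (Set.Icc a b) x / (2 * Real.pi * Λ) : ℝ)))‖
      ≤ approxConst κ C * (Λ * (b - a)) ^ (-(κ : ℝ) - α)
          * (1 + |s|) ^ (κ + (κ + 1) * (κ + 1) + 1) := by
  obtain ⟨P, hP0, hP⟩ := exists_polynomial_mul_exp_approx h.C_nonneg h.length_pos h.Λ_pos hR
    (W := fun j ↦ iteratedDeriv j w x) (fun j hj ↦ h.norm_deriv_le j hj x hx)
    (Φ := fun j ↦ iteratedDerivWithin j φ (Set.Icc a b) x)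
    (fun j h1 h2 ↦ h.abs_deriv_le j h1 h2 x hx)
  refine ⟨P, by simpa using hP0, fun s ↦ ?_⟩
  have hPs := hP s
  simp only [iteratedDerivWithin_one] at hPs
  have hC := h.C_nonneg
  set R := Λ * (b - a) with hRdef
  set N := κ + (κ + 1) * (κ + 1) + 1 with hN
  have hs0 := abs_nonneg s
  have hs1 : 1 ≤ 1 + |s| := by linarith
  have hR0 : 0 < R := by linarith
  set pw := ∑ j ∈ Finset.range (κ + 1), ((-(s / Λ)) ^ j / j.factorial) • iteratedDeriv j w x
    with hpw
  set pφ := ∑ j ∈ Finset.range (κ + 1 + 1),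
    (-(s / Λ)) ^ j / j.factorial * iteratedDerivWithin j φ (Set.Icc a b) x with hpφ
  have hwT : ‖w (x - s / Λ) - pw‖ ≤ C * R ^ (-(κ : ℝ) - α) * (1 + |s|) ^ N := by
    refine (h.norm_sub_taylor_le x s).trans ?_
    gcongr
    exact (abs_rpow_le_one_add_pow h.α_nonneg h.α_le_one κ s).trans
      (pow_le_pow_right₀ hs1 (by rw [hN]; nlinarith))
  have hφT : ‖(Complex.exp (Complex.I * (φ (x - s / Λ) : ℂ)) - Complex.exp (Complex.I * (pφ : ℂ)))
      * w (x - s / Λ)‖ ≤ C * C * R ^ (-(κ : ℝ) - α) * (1 + |s|) ^ N := by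
    -- The phase expansion is available only inside the interval; outside it the factor `w`
    -- vanishes.
    by_cases hs : x - s / Λ ∈ Set.Icc a b
    · have h1 : ‖Complex.exp (Complex.I * (φ (x - s / Λ) : ℂ)) - Complex.exp (Complex.I * (pφ : ℂ))‖
          ≤ |φ (x - s / Λ) - pφ| := by
        have := Real.norm_exp_I_mul_ofReal_sub_one_le (x := φ (x - s / Λ) - pφ)
        calc _ = ‖Complex.exp (Complex.I * (pφ : ℂ)) *
              (Complex.exp (Complex.I * ((φ (x - s / Λ) - pφ : ℝ) : ℂ)) - 1)‖ := by
              rw [mul_sub, ← Complex.exp_add, mul_one]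
              congr 3
              push_cast
              ring
          _ ≤ _ := by
              rw [norm_mul, mul_comm Complex.I (pφ : ℂ), Complex.norm_exp_ofReal_mul_I, one_mul]
              exact this
      have h2 := h.abs_phase_sub_taylor_le hx hs
      rw [norm_mul]
      calc _ ≤ (C * R ^ (-(κ : ℝ) - α) * |s| ^ (κ + α) * |s|) * C := by
            gcongr
            · exact h1.trans h2
            · exact h.norm_le _
        _ ≤ (C * R ^ (-(κ : ℝ) - α) * (1 + |s|) ^ (κ + 1) * (1 + |s|)) * C := by
            gcongr
            · exact abs_rpow_le_one_add_pow h.α_nonneg h.α_le_one κ s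
            · linarith
        _ = C * C * R ^ (-(κ : ℝ) - α) * (1 + |s|) ^ (κ + 1 + 1) := by ring
        _ ≤ _ := by
            refine mul_le_mul_of_nonneg_left (pow_le_pow_right₀ hs1 ?_) (by positivity)
            rw [hN]
            nlinarith
    · rw [h.eq_zero hs, mul_zero, norm_zero]
      positivity
  have hPT : (κ + 1) * C * (κ * C) ^ (κ + 1) * R⁻¹ ^ (κ + 1)
      * (1 + |s|) ^ (κ + (κ + 1) * (κ + 1))
      ≤ (κ + 1) * C * (κ * C) ^ (κ + 1) * R ^ (-(κ : ℝ) - α) * (1 + |s|) ^ N := by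
    -- The truncation error has exponent `κ + 1 ≥ κ + α`, an improvement because `R ≥ 1`.
    have hRp : R⁻¹ ^ (κ + 1) ≤ R ^ (-(κ : ℝ) - α) := by
      rw [inv_pow, ← Real.rpow_natCast, ← Real.rpow_neg hR0.le]
      refine Real.rpow_le_rpow_of_exponent_le hR ?_
      push_cast
      linarith [h.α_le_one]
    have : (1 + |s|) ^ (κ + (κ + 1) * (κ + 1)) ≤ (1 + |s|) ^ N :=
      pow_le_pow_right₀ hs1 (by omega)
    gcongr
  have hsum : Complex.exp (Complex.I * (φ (x - s / Λ) : ℂ)) * w (x - s / Λ) - P.eval (s : ℂ) *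
          Complex.exp (-(2 * Real.pi * Complex.I * s *
            (derivWithin φ (Set.Icc a b) x / (2 * Real.pi * Λ) : ℝ)))
      = Complex.exp (Complex.I * (pφ : ℂ)) * (w (x - s / Λ) - pw)
        + (Complex.exp (Complex.I * (φ (x - s / Λ) : ℂ)) - Complex.exp (Complex.I * (pφ : ℂ)))
          * w (x - s / Λ)
        + (Complex.exp (Complex.I * (pφ : ℂ)) * pw - P.eval (s : ℂ) *
          Complex.exp (-(2 * Real.pi * Complex.I * s *
            (derivWithin φ (Set.Icc a b) x / (2 * Real.pi * Λ) : ℝ)))) := by ring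
  have hwT' : ‖Complex.exp (Complex.I * (pφ : ℂ)) * (w (x - s / Λ) - pw)‖
      ≤ C * R ^ (-(κ : ℝ) - α) * (1 + |s|) ^ N := by
    rwa [norm_mul, mul_comm Complex.I (pφ : ℂ), Complex.norm_exp_ofReal_mul_I, one_mul]
  rw [hsum]
  refine (norm_add₃_le.trans (add_le_add (add_le_add hwT' hφT) (hPs.trans hPT))).trans
    (le_of_eq ?_)
  unfold approxConst
  ring

/-- Away from the interval `e^{iφ}w` is small, with decay in the distance. -/
theorem norm_mul_le_of_notMem (h : OscillatoryData κ α C a b w φ Λ) {x : ℝ} (hx : x ∉ Set.Icc a b)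
    {m : ℝ} (hm : 0 < m) (s : ℝ) :
    ‖Complex.exp (Complex.I * (φ (x - s / Λ) : ℂ)) * w (x - s / Λ)‖
      ≤ C * (Λ * (b - a)) ^ (-(κ : ℝ) - α) / (1 + Λ * Metric.infDist x (Set.Icc a b)) ^ m
        * (1 + |s|) ^ (κ + 1 + ⌈m⌉₊) := by
  have hC := h.C_nonneg
  have hΛ := h.Λ_pos
  have hL := h.length_pos
  have hs0 := abs_nonneg s
  have hd0 : 0 ≤ Metric.infDist x (Set.Icc a b) := Metric.infDist_nonneg
  rw [norm_mul_eq]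
  by_cases hs : x - s / Λ ∈ Set.Icc a b
  · have hw := h.norm_sub_taylor_le x s
    -- All Taylor coefficients at `x ∉ I` vanish, so the remainder bound is a bound for `w (x - s /
    -- Λ)` itself.
    rw [Finset.sum_eq_zero fun j _ ↦ by
      rw [iteratedDeriv_eq_zero_of_support_subset_Icc h.support_subset j hx, smul_zero],
      sub_zero] at hw
    have hd : Λ * Metric.infDist x (Set.Icc a b) ≤ |s| := by
      have := Metric.infDist_le_dist_of_mem (x := x) hs
      rw [Real.dist_eq, sub_sub_cancel, abs_div, abs_of_pos hΛ, le_div_iff₀ hΛ] at this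
      linarith
    have hdm : (1 + Λ * Metric.infDist x (Set.Icc a b)) ^ m ≤ (1 + |s|) ^ ⌈m⌉₊ := by
      rw [← Real.rpow_natCast]
      calc _ ≤ (1 + |s|) ^ m := by gcongr
        _ ≤ _ := Real.rpow_le_rpow_of_exponent_le (by linarith) (Nat.le_ceil m)
    have hpos : 0 < (1 + Λ * Metric.infDist x (Set.Icc a b)) ^ m :=
      Real.rpow_pos_of_pos (by positivity) _
    rw [div_mul_eq_mul_div, le_div_iff₀ hpos, pow_add, ← mul_assoc]
    gcongr
    refine hw.trans ?_
    gcongr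
    exact abs_rpow_le_one_add_pow h.α_nonneg h.α_le_one κ s
  · rw [h.eq_zero hs, norm_zero]
    positivity

/-- The frequency `φ'` varies by at most `C Λ`. -/
theorem abs_derivWithin_sub_le (h : OscillatoryData κ α C a b w φ Λ) {x y : ℝ}
    (hx : x ∈ Set.Icc a b) (hy : y ∈ Set.Icc a b) :
    |derivWithin φ (Set.Icc a b) x - derivWithin φ (Set.Icc a b) y| ≤ C * Λ := by
  have hL := h.length_pos
  have hC := h.C_nonneg
  have hΛ := h.Λ_pos
  have hxy : |x - y| ≤ b - a := abs_le.2 ⟨by linarith [hx.1, hy.2], by linarith [hx.2, hy.1]⟩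
  -- For `κ = 0` there is no bound on `φ''`; the Hölder condition on `φ'` with `|x - y| ≤ b - a`
  -- replaces it.
  rcases Nat.eq_zero_or_pos κ with rfl | hκ
  · have h1 := h.abs_deriv_sub_le x hx y hy
    simp only [zero_add, iteratedDerivWithin_one, Nat.cast_zero, neg_zero, zero_sub] at h1
    refine h1.trans ?_
    calc _ ≤ C * Λ * (b - a) ^ (-α) * (b - a) ^ α := by
          gcongr
          exact h.α_nonneg
      _ = C * Λ := by
          rw [Real.rpow_neg hL.le, inv_mul_cancel_right₀ (Real.rpow_pos_of_pos hL _).ne']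
  · have hd : ∀ z ∈ Set.Icc a b, HasDerivWithinAt (derivWithin φ (Set.Icc a b))
        (iteratedDerivWithin 2 φ (Set.Icc a b) z) (Set.Icc a b) z := by
      intro z hz
      have := (h.contDiffOn.differentiableOn_iteratedDerivWithin (m := 1)
        (mod_cast Nat.lt_succ_of_le hκ) (uniqueDiffOn_Icc h.lt) z hz).hasDerivWithinAt
      have h1 : iteratedDerivWithin 1 φ (Set.Icc a b) = derivWithin φ (Set.Icc a b) :=
        iteratedDerivWithin_one
      rw [iteratedDerivWithin_succ, h1]
      rwa [h1] at this
    have hb := (convex_Icc a b).norm_image_sub_le_of_norm_hasDerivWithin_le hd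
      (fun z hz ↦ h.abs_deriv_le 1 le_rfl hκ z hz) hy hx
    rw [Real.norm_eq_abs, Real.norm_eq_abs] at hb
    refine hb.trans ?_
    calc _ ≤ C * Λ / (b - a) ^ 1 * (b - a) := by gcongr
      _ = C * Λ := by field_simp

end OscillatoryData

/-! ### Convolution with the dilated kernel. -/

theorem SchwartzMap.integrable_one_add_abs_pow_mul_norm (r : 𝓢(ℝ, ℂ)) (N : ℕ) :
    Integrable fun s : ℝ ↦ (1 + |s|) ^ N * ‖r s‖ := by
  simp_rw [add_comm (1 : ℝ), add_pow, Finset.sum_mul]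
  refine integrable_finsetSum _ fun n _ ↦ ?_
  refine ((r.integrable_pow_mul volume n).const_mul (N.choose n : ℝ)).congr
    (Filter.Eventually.of_forall fun s ↦ ?_)
  simp only [Real.norm_eq_abs, one_pow, mul_one]
  ring

theorem norm_integral_mul_kernel_le {r : 𝓢(ℝ, ℂ)} {k u : ℝ → ℂ} {B D : ℝ} {N : ℕ} (hB : 0 ≤ B)
    (hk : ∀ s, ‖k s‖ ≤ D * ‖r s‖) (hu : ∀ s, ‖u s‖ ≤ B * (1 + |s|) ^ N) :
    ‖∫ s, u s * k s‖ ≤ B * D * ∫ s, (1 + |s|) ^ N * ‖r s‖ := by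
  rw [← integral_const_mul]
  refine norm_integral_le_of_norm_le ((r.integrable_one_add_abs_pow_mul_norm N).const_mul _)
    (Filter.Eventually.of_forall fun s ↦ ?_)
  rw [norm_mul]
  calc ‖u s‖ * ‖k s‖ ≤ (B * (1 + |s|) ^ N) * (D * ‖r s‖) := by
        gcongr
        · exact hu s
        · exact hk s
    _ = _ := by ring

/-- Convolution with the dilated kernel `Λ k(Λ ·)`. -/
noncomputable def dilatedConvolution (Λ : ℝ) (k g : ℝ → ℂ) : ℝ → ℂ :=
  MeasureTheory.convolution (fun t ↦ (Λ : ℂ) * k (Λ * t)) g (ContinuousLinearMap.mul ℂ ℂ) volume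

theorem dilatedConvolution_apply {Λ : ℝ} (hΛ : 0 < Λ) (k g : ℝ → ℂ) (x : ℝ) :
    dilatedConvolution Λ k g x = ∫ s, g (x - s / Λ) * k s := by
  have h := Measure.integral_comp_mul_left (fun s ↦ g (x - s / Λ) * k s) Λ
  rw [abs_of_pos (inv_pos.2 hΛ), eq_inv_smul_iff₀ hΛ.ne', ← integral_smul] at h
  rw [← h]
  unfold dilatedConvolution MeasureTheory.convolution
  congr with t
  rw [mul_div_cancel_left₀ _ hΛ.ne', ContinuousLinearMap.mul_apply', Complex.real_smul]
  ring

theorem integrable_dilatedConvolution {Λ : ℝ} (hΛ : 0 < Λ) {k g : ℝ → ℂ} (hk : Integrable k)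
    (hg : Integrable g) : Integrable (dilatedConvolution Λ k g) :=
  ((hk.comp_mul_left' hΛ.ne').const_mul _).integrable_convolution _ hg

theorem fourier_dilatedConvolution {Λ : ℝ} (hΛ : 0 < Λ) {k g : ℝ → ℂ} (hk : Integrable k)
    (hg : Integrable g) (ξ : ℝ) :
    𝓕 (dilatedConvolution Λ k g) ξ = 𝓕 k (ξ / Λ) * 𝓕 g ξ := by
  unfold dilatedConvolution
  rw [Real.fourier_mul_convolution_eq ((hk.comp_mul_left' hΛ.ne').const_mul _) hg]
  congr 1
  rw [Real.fourier_real_eq_integral_exp_smul, Real.fourier_real_eq_integral_exp_smul]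
  have h := Measure.integral_comp_mul_left (fun v : ℝ ↦
    Complex.exp (((-2 * Real.pi * v * (ξ / Λ) : ℝ) : ℂ) * Complex.I) • k v) Λ
  rw [abs_of_pos (inv_pos.2 hΛ), eq_inv_smul_iff₀ hΛ.ne', ← integral_smul] at h
  rw [← h]
  congr with t
  rw [show -2 * Real.pi * (Λ * t) * (ξ / Λ) = -2 * Real.pi * t * ξ by field_simp]
  simp only [smul_eq_mul, Complex.real_smul]
  ring

namespace OscillatoryData

variable {κ : ℕ} {α C a b : ℝ} {w : ℝ → ℂ} {φ : ℝ → ℝ} {Λ : ℝ}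

theorem norm_sub_dilatedConvolution_le (h : OscillatoryData κ α C a b w φ Λ)
    (hR : 1 ≤ Λ * (b - a)) {r : 𝓢(ℝ, ℂ)} {k : ℝ → ℂ} {D : ℝ} (hki : Integrable k)
    (hk : ∀ s, ‖k s‖ ≤ D * ‖r s‖)
    (hmom : ∀ x ∈ Set.Icc a b, ∀ P : Polynomial ℂ,
      Integrable (fun s : ℝ ↦ P.eval (s : ℂ) * Complex.exp (-(2 * Real.pi * Complex.I * s *
        (derivWithin φ (Set.Icc a b) x / (2 * Real.pi * Λ) : ℝ))) * k s) ∧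
      ∫ s : ℝ, P.eval (s : ℂ) * Complex.exp (-(2 * Real.pi * Complex.I * s *
        (derivWithin φ (Set.Icc a b) x / (2 * Real.pi * Λ) : ℝ))) * k s = P.eval 0)
    {m : ℝ} (hm : 0 < m) (x : ℝ) :
    ‖Complex.exp (Complex.I * (φ x : ℂ)) * w x
        - dilatedConvolution Λ k (fun y ↦ Complex.exp (Complex.I * (φ y : ℂ)) * w y) x‖
      ≤ approxConst κ C * (Λ * (b - a)) ^ (-(κ : ℝ) - α)
          / (1 + Λ * Metric.infDist x (Set.Icc a b)) ^ m * D
        * ∫ s, (1 + |s|) ^ (κ + (κ + 1) * (κ + 1) + 1 + ⌈m⌉₊) * ‖r s‖ := by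
  have hC := h.C_nonneg
  have hΛ := h.Λ_pos
  have hL := h.length_pos
  have hA := hC.trans (le_approxConst κ hC)
  have hd0 : 0 ≤ Metric.infDist x (Set.Icc a b) := Metric.infDist_nonneg
  have hB : 0 ≤ approxConst κ C * (Λ * (b - a)) ^ (-(κ : ℝ) - α)
      / (1 + Λ * Metric.infDist x (Set.Icc a b)) ^ m := by positivity
  rw [dilatedConvolution_apply hΛ]
  by_cases hx : x ∈ Set.Icc a b
  · obtain ⟨P, hP0, hP⟩ := h.exists_polynomial_approx hR hx
    obtain ⟨hPi, hPint⟩ := hmom x hx P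
    have hgi : Integrable fun s ↦
        Complex.exp (Complex.I * (φ (x - s / Λ) : ℂ)) * w (x - s / Λ) * k s := by
      have hcont := h.continuous_mul.comp (g := fun y ↦ Complex.exp (Complex.I * (φ y : ℂ)) * w y)
        (f := fun s ↦ x - s / Λ) (by fun_prop)
      refine hki.bdd_mul (c := C) hcont.aestronglyMeasurable
        (Filter.Eventually.of_forall fun s ↦ ?_)
      exact (norm_mul_eq (φ := φ) (w := w) (x - s / Λ)).trans_le (h.norm_le _)
    -- The value at `x` becomes the integral of the model against `k`, so the error is the integral
    -- of a pointwise small difference.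
    rw [norm_sub_rev, ← hP0, ← hPint, ← integral_sub hgi hPi]
    simp_rw [← sub_mul]
    refine norm_integral_mul_kernel_le hB hk fun s ↦ (hP s).trans ?_
    rw [Metric.infDist_zero_of_mem hx, mul_zero, add_zero, Real.one_rpow, div_one]
    refine mul_le_mul_of_nonneg_left (pow_le_pow_right₀ ?_ (Nat.le_add_right _ _)) (by positivity)
    linarith [abs_nonneg s]
  · rw [h.eq_zero hx, mul_zero, zero_sub, norm_neg]
    refine norm_integral_mul_kernel_le hB hk fun s ↦ (h.norm_mul_le_of_notMem hx hm s).trans ?_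
    have hs : 1 ≤ 1 + |s| := by linarith [abs_nonneg s]
    have hpow : (1 + |s|) ^ (κ + 1 + ⌈m⌉₊)
        ≤ (1 + |s|) ^ (κ + (κ + 1) * (κ + 1) + 1 + ⌈m⌉₊) :=
      pow_le_pow_right₀ hs (by nlinarith)
    have := le_approxConst κ hC
    gcongr

theorem norm_mul_le_of_length_le (h : OscillatoryData κ α C a b w φ Λ) (hR : Λ * (b - a) ≤ 1)
    (m x : ℝ) :
    ‖Complex.exp (Complex.I * (φ x : ℂ)) * w x‖
      ≤ C * ((Λ * (b - a)) ^ (-(κ : ℝ) - α) / (1 + Λ * Metric.infDist x (Set.Icc a b)) ^ m) := by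
  have hC := h.C_nonneg
  have hΛ := h.Λ_pos
  have hL := h.length_pos
  have hd0 : 0 ≤ Metric.infDist x (Set.Icc a b) := Metric.infDist_nonneg
  rw [norm_mul_eq]
  by_cases hx : x ∈ Set.Icc a b
  · rw [Metric.infDist_zero_of_mem hx, mul_zero, add_zero, Real.one_rpow, div_one]
    refine (h.norm_le x).trans (le_mul_of_one_le_right hC ?_)
    refine Real.one_le_rpow_of_pos_of_le_one_of_nonpos (by positivity) hR ?_
    have := h.α_nonneg
    have : (0 : ℝ) ≤ κ := Nat.cast_nonneg κ
    linarith
  · rw [h.eq_zero hx, norm_zero]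
    positivity

end OscillatoryData

/-! ### Assembly. -/

theorem mainTheorem4 (κ : ℕ) (α : ℝ) (hα : α ∈ Set.Icc (0 : ℝ) 1) (C : ℝ) :
    ∃ K : ℝ → ℝ,
      ∀ (a b : ℝ), a < b →
      ∀ (w : ℝ → ℂ),
        HolderClass κ α Set.univ w →
        Function.support w ⊆ Set.Icc a b →
        (∀ j : ℕ, j ≤ κ → ∀ x ∈ Set.Icc a b, ‖iteratedDeriv j w x‖ ≤ C * (b - a) ^ (-(j : ℝ))) →
        (∀ x ∈ Set.Icc a b, ∀ y ∈ Set.Icc a b,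
          ‖iteratedDeriv κ w x - iteratedDeriv κ w y‖
            ≤ C * (b - a) ^ (-(κ : ℝ) - α) * |x - y| ^ α) →
      ∀ (φ : ℝ → ℝ) (Λ : ℝ), 0 < Λ →
        HolderClass (κ + 1) α (Set.Icc a b) φ →
        (∀ j : ℕ, 1 ≤ j → j ≤ κ → ∀ x ∈ Set.Icc a b,
          |iteratedDerivWithin (j + 1) φ (Set.Icc a b) x| ≤ C * Λ * (b - a) ^ (-(j : ℝ))) →
        (∀ x ∈ Set.Icc a b, ∀ y ∈ Set.Icc a b,
          |iteratedDerivWithin (κ + 1) φ (Set.Icc a b) x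
              - iteratedDerivWithin (κ + 1) φ (Set.Icc a b) y|
            ≤ C * Λ * (b - a) ^ (-(κ : ℝ) - α) * |x - y| ^ α) →
      ∃ E : ℝ → ℂ,
        MeasureTheory.Integrable E MeasureTheory.volume ∧
        (∀ m : ℝ, 0 < m → ∀ x : ℝ,
          ‖Complex.exp (Complex.I * (φ x : ℂ)) * w x - E x‖
            ≤ K m * ((Λ * (b - a)) ^ (-(κ : ℝ) - α)
                / (1 + Λ * Metric.infDist x (Set.Icc a b)) ^ m)) ∧
        (∀ ξ : ℝ,
          Λ / (4 * Real.pi)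
              < (⨅ x : Set.Icc a b,
                  |ξ - derivWithin φ (Set.Icc a b) (x : ℝ) / (2 * Real.pi)|) →
          𝓕 E ξ = 0) := by
  have hpi := Real.pi_pos
  -- This `δ` is the allowed spectral margin `Λ/(4π)` in frequency units of `Λ`.
  obtain ⟨r, hr⟩ := exists_bandKernel (δ := 1 / (4 * Real.pi)) (by positivity)
  let J : ℝ → ℝ := fun m ↦ ∫ s, (1 + |s|) ^ (κ + (κ + 1) * (κ + 1) + 1 + ⌈m⌉₊) * ‖r s‖
  have hJ (m : ℝ) : 0 ≤ J m := integral_nonneg fun s ↦ by positivity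
  -- The first summand serves `Λ L ≤ 1`; in the second, `C + 1` bounds `q - p + δ`.
  refine ⟨fun m ↦ C + approxConst κ C * (C + 1) * J m, ?_⟩
  intro a b hab w hw hsupp hwb hwh φ Λ hΛ hφ hφb hφh
  have hL : 0 < b - a := sub_pos.2 hab
  have hpow (c : ℝ) (j : ℕ) : c * (b - a) ^ (-(j : ℝ)) = c / (b - a) ^ j := by
    rw [Real.rpow_neg hL.le, Real.rpow_natCast, div_eq_mul_inv]
  have hC : 0 ≤ C := by
    have := (norm_nonneg _).trans (hwb 0 (Nat.zero_le _) a (Set.left_mem_Icc.2 hab.le))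
    simpa using this
  have h : OscillatoryData κ α C a b w φ Λ :=
    { lt := hab, Λ_pos := hΛ, C_nonneg := hC, α_nonneg := hα.1, α_le_one := hα.2
      contDiff := contDiffOn_univ.1 hw.1
      support_subset := hsupp
      norm_deriv_le := fun j hj x hx ↦ (hwb j hj x hx).trans_eq (hpow C j)
      norm_deriv_sub_le := hwh
      contDiffOn := hφ.1
      abs_deriv_le := fun j h1 h2 x hx ↦ (hφb j h1 h2 x hx).trans_eq (hpow _ j)
      abs_deriv_sub_le := hφh }
  have hA := hC.trans (le_approxConst κ hC)
  rcases le_total (Λ * (b - a)) 1 with hR | hR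
  · refine ⟨0, integrable_zero _ _ _, fun m _ x ↦ ?_, fun ξ _ ↦ ?_⟩
    · rw [Pi.zero_apply, sub_zero]
      refine (h.norm_mul_le_of_length_le hR m x).trans ?_
      have := hJ m
      have hd0 : 0 ≤ Metric.infDist x (Set.Icc a b) := Metric.infDist_nonneg
      refine mul_le_mul_of_nonneg_right ?_ (by positivity)
      exact le_add_of_nonneg_right (by positivity)
    · rw [Real.fourier_real_eq_integral_exp_smul]
      simp
  · let f : ℝ → ℝ := fun x ↦ derivWithin φ (Set.Icc a b) x / (2 * Real.pi * Λ)
    have hf : ContinuousOn f (Set.Icc a b) :=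
      (hφ.1.continuousOn_derivWithin (uniqueDiffOn_Icc hab)
        (mod_cast Nat.succ_le_succ (Nat.zero_le κ))).div_const _
    -- By the intermediate value theorem the frequencies fill `[p, q]`, so being far from every `f
    -- x` means being far from the whole band.
    have himage := hf.image_Icc hab.le
    set p := sInf (f '' Set.Icc a b)
    set q := sSup (f '' Set.Icc a b)
    have hmem : ∀ x ∈ Set.Icc a b, f x ∈ Set.Icc p q := fun x hx ↦
      himage ▸ Set.mem_image_of_mem f hx
    have hpq : p ≤ q := by
      have := hmem a (Set.left_mem_Icc.2 hab.le)
      exact this.1.trans this.2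
    obtain ⟨k, hki, hk, hmom, hzero⟩ := hr p q hpq
    obtain ⟨xp, hxp, hfp⟩ : p ∈ f '' Set.Icc a b := himage ▸ Set.left_mem_Icc.2 hpq
    obtain ⟨xq, hxq, hfq⟩ : q ∈ f '' Set.Icc a b := himage ▸ Set.right_mem_Icc.2 hpq
    have hD : q - p + 1 / (4 * Real.pi) ≤ C + 1 := by
      have h1 : q - p ≤ C := by
        have := (le_abs_self _).trans (h.abs_derivWithin_sub_le hxq hxp)
        rw [← hfp, ← hfq]
        simp only [f]
        rw [← sub_div, div_le_iff₀ (by positivity)]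
        nlinarith [mul_nonneg hC hΛ.le, Real.pi_gt_three]
      have h2 : 1 / (4 * Real.pi) ≤ 1 := by
        rw [div_le_one (by positivity)]
        linarith [Real.pi_gt_three]
      linarith
    refine ⟨dilatedConvolution Λ k (fun y ↦ Complex.exp (Complex.I * (φ y : ℂ)) * w y),
      integrable_dilatedConvolution hΛ hki h.integrable_mul, fun m hm x ↦ ?_, fun ξ hξ ↦ ?_⟩
    · have hd0 : 0 ≤ Metric.infDist x (Set.Icc a b) := Metric.infDist_nonneg
      refine (h.norm_sub_dilatedConvolution_le hR hki
        (fun s ↦ (hk s).trans (mul_le_mul_of_nonneg_right hD (norm_nonneg _)))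
        (fun x hx P ↦ hmom (f x) (hmem x hx) P) hm x).trans ?_
      set T := (Λ * (b - a)) ^ (-(κ : ℝ) - α) / (1 + Λ * Metric.infDist x (Set.Icc a b)) ^ m
        with hT
      have hT0 : 0 ≤ T := by positivity
      calc _ = approxConst κ C * (C + 1) * J m * T := by rw [hT]; ring
        _ ≤ _ := by
          refine mul_le_mul_of_nonneg_right ?_ hT0
          exact le_add_of_nonneg_left hC
    · have hlt : ∀ x ∈ Set.Icc a b, 1 / (4 * Real.pi) < |ξ / Λ - f x| := by
        intro x hx
        have hle := hξ.trans_le (ciInf_le ⟨0, by rintro _ ⟨y, rfl⟩; exact abs_nonneg _⟩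
          (⟨x, hx⟩ : Set.Icc a b))
        have : ξ / Λ - f x = (ξ - derivWithin φ (Set.Icc a b) x / (2 * Real.pi)) / Λ := by
          simp only [f]
          field_simp
        rw [this, abs_div, abs_of_pos hΛ, lt_div_iff₀ hΛ]
        calc _ = Λ / (4 * Real.pi) := by ring
          _ < _ := hle
      rw [fourier_dilatedConvolution hΛ hki h.integrable_mul, hzero, zero_mul]
      intro hmem'
      have hδ : 0 < 1 / (4 * Real.pi) := by positivity
      rcases lt_or_ge (ξ / Λ) p with h1 | h1
      · have := hlt xp hxp
        rw [hfp, abs_of_neg (by linarith)] at this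
        linarith [hmem'.1]
      rcases lt_or_ge q (ξ / Λ) with h2 | h2
      · have := hlt xq hxq
        rw [hfq, abs_of_pos (by linarith)] at this
        linarith [hmem'.2]
      · obtain ⟨x, hx, hfx⟩ : ξ / Λ ∈ f '' Set.Icc a b := himage ▸ ⟨h1, h2⟩
        have := hlt x hx
        rw [hfx, sub_self, abs_zero] at this
        linarith
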